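/- Let $n, C\ge 0$ be integers and let $T_1,\dots,T_n$ be finite sets (the tools required for jobs $1,\dots,n$) with $|T_i|\le C$ for all $i$ and $C\le m:=\left|\bigcup_{i=1}^n T_i\right|$ ($C$ is the magazine capacity). Let $\boldsymbol M$ be the set of all sequences $M=(M_1,\dots,M_n)$ of sets of tools with $T_i\subseteq M_i$ and $|M_i|=C$ for all $i$. For a sequence $L=(L_1,\dots,L_n)$ of finite sets of tools put $switches(L)=\sum_{i=1}^{n-1}|L_{i+1}\setminus L_i|$. The Tool Loading Problem (TLP) asks for an element of $\boldsymbol M$ that minimizes $switches$. A possible pipe is a triple $(s,e,t)$ with $1\le s<e\le n$, $t\in T_s\cap T_e$ and $t\notin T_i$ for $s<i<e$. It is a pipe of $L$ if moreover $t\in L_i$ for all $s<i<e$. Let $\mathscr P(L)$ be the set of pipes of $L$. GPCA: start with $L_i:=T_i$ for all $i$ and $pipes\_count:=0$. For $e=2,\dots,n$ in this order, run through all possible pipes $(s,e,t)$ with ending moment $e$, in any order; if $|L_i|<C$ for all $s<i<e$, build the pipe: add $t$ to $L_i$ for all $s<i<e$, and increase $pipes\_count$ by $1$. Let $L$ be the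 final sequence and let $GPCA(T_1,\dots,T_n;C)$ be the final value of $pipes\_count$. ToFullMag: start with $M:=L$. For $(i,j)=(1,2),(2,3),\dots,(n-1,n),(n,n-1),(n-1,n-2),\dots,(2,1)$ in this order, run through the tools $t\in M_i$ in any order; if $t$ was not in $M_j$ at the beginning of this step and currently $|M_j|<C$, add $t$ to $M_j$. Let $M^*$ be the final sequence. Then, for all orders of enumeration in the two algorithms: (1) GPCA builds a maximum number of pipes, i.e. $GPCA(T_1,\dots,T_n;C)=|\mathscr P(L)|=\max\{|\mathscr P(M)| : M\in\boldsymbol M\}$, and $$\min\{switches(M): M\in\boldsymbol M\}=\sum_{i=1}^n|T_i|-C-GPCA(T_1,\dots,T_n;C).$$ (2) ToFullMag applied to the output $L$ of GPCA fills the empty slots without adding switches and gives an optimal solution of the TLP: $L_i\subseteq M^*_i$ for all $i$, $switches(M^*)\le switches(L)$, $M^*\in\boldsymbol M$, and $switches(M^*)=\min\{switches(M): M\in\boldsymbol M\}$. -/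

import Mathlib

namespace ToolLoading

variable {n : ℕ} {α : Type*} [DecidableEq α]

/-- The set of all sequences of full magazine states of capacity `C` with which the jobs
requiring the tool sets `T 0, …, T (n - 1)` can be processed in this order. -/
def magSeqs (T : Fin n → Finset α) (C : ℕ) : Set (Fin n → Finset α) :=
  {M | ∀ i, T i ⊆ M i ∧ (M i).card = C}

/-- The pairs `(i, i + 1)` of consecutive moments, in increasing order of `i`. -/
def consecutive (n : ℕ) : List (Fin n × Fin n) :=
  (List.finRange (n - 1)).map fun i : Fin (n - 1) =>
    ((⟨(i : ℕ), by omega⟩ : Fin n), (⟨(i : ℕ) + 1, by omega⟩ : Fin n))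

/-- The number of tool switches: the sum of `|M (i + 1) \ M i|` over consecutive moments. -/
def switches (M : Fin n → Finset α) : ℕ :=
  ∑ i : Fin (n - 1), (M ⟨i + 1, by omega⟩ \ M ⟨i, by omega⟩).card

/-- A triple `(s, e, t)`: starting moment, ending moment, tool. -/
abbrev Triple (n : ℕ) (α : Type*) := Fin n × Fin n × α

/-- All possible pipes `(s, e, t)`: the tool `t` is needed at the moments `s < e` and at no moment
strictly between them. -/
def possiblePipes (T : Fin n → Finset α) : Finset (Triple n α) :=
  (Finset.univ ×ˢ Finset.univ ×ˢ Finset.univ.biUnion T).filter fun p =>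
    p.1 < p.2.1 ∧ p.2.2 ∈ T p.1 ∧ p.2.2 ∈ T p.2.1 ∧ ∀ i ∈ Finset.Ioo p.1 p.2.1, p.2.2 ∉ T i

/-- The pipes of the sequence of states `M`: the possible pipes `(s, e, t)` such that `t` is kept
in the magazine at all moments strictly between `s` and `e`. -/
def pipes (T M : Fin n → Finset α) : Finset (Triple n α) :=
  (possiblePipes T).filter fun p => ∀ i ∈ Finset.Ioo p.1 p.2.1, p.2.2 ∈ M i

/-- The possible pipes that end at the moment `e`. -/
def candidates (T : Fin n → Finset α) (e : Fin n) : Finset (Triple n α) :=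
  (possiblePipes T).filter fun p => p.2.1 = e

/-- `σ` chooses, for each step `k` of an algorithm, an order in which the elements of a finite set
are enumerated at this step. -/
def IsEnumeration {κ β : Type*} (σ : κ → Finset β → List β) : Prop :=
  ∀ k S, (σ k S).Nodup ∧ ∀ x, x ∈ σ k S ↔ x ∈ S

/-- Build the pipe `p` in the current states and increase the counter of pipes, if all states
strictly between the ends of `p` have an empty slot; otherwise do nothing. -/
def tryBuild (C : ℕ) (st : (Fin n → Finset α) × ℕ) (p : Triple n α) :
    (Fin n → Finset α) × ℕ :=
  if ∀ i ∈ Finset.Ioo p.1 p.2.1, (st.1 i).card < C then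
    (fun i => if i ∈ Finset.Ioo p.1 p.2.1 then insert p.2.2 (st.1 i) else st.1 i, st.2 + 1)
  else st

/-- The greedy pipe construction algorithm, started with the states `T` and the counter `0`. The
ending moment runs in increasing order from the second moment to the last one, and the candidates
that end at `e` are tried in the order `σ e`. The result is the pair of the final sequence of
states and the number of pipes built. -/
def GPCA (T : Fin n → Finset α) (C : ℕ)
    (σ : Fin n → Finset (Triple n α) → List (Triple n α)) : (Fin n → Finset α) × ℕ :=
  (List.finRange n).tail.foldl
    (fun st e => (σ e (candidates T e)).foldl (tryBuild C) st) (T, 0)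

/-- One step of `toFullMag`, for a pair `(i, j)`: run through the tools of `M i` in the order `l`,
and add to the `j`-th state each of them which was not in it before this step, as long as the
`j`-th state has an empty slot. -/
def fillStep (C : ℕ) (M : Fin n → Finset α) (j : Fin n) (l : List α) : Fin n → Finset α :=
  Function.update M j
    (l.foldl (fun S t => if t ∉ M j ∧ S.card < C then insert t S else S) (M j))

/-- The algorithm ToFullMag: perform `fillStep` for the pairs
`(1, 2), (2, 3), …, (n - 1, n), (n, n - 1), …, (2, 1)`, where the tools of the current state at
the first moment of the pair `p` are enumerated in the order `τ p`. -/
def toFullMag (C : ℕ) (τ : Fin n × Fin n → Finset α → List α) (L : Fin n → Finset α) :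
    Fin n → Finset α :=
  (consecutive n ++ ((consecutive n).map Prod.swap).reverse).foldl
    (fun M p => fillStep C M p.2 (τ p (M p.1))) L

end ToolLoading

open ToolLoading

/-! Set `c i = C - |T i|`. Possible pipes that cover a moment `i` carry distinct tools outside `T
i`, so a set of possible pipes can be built exactly when every `i` is covered by at most `c i` of
them (`card_build`). GPCA is thus the greedy algorithm for packing open intervals under capacities,
in the order of their right ends. An exchange argument (`exists_exchange`,
`card_le_card_foldl_accept`) shows that it finds a largest feasible set `B`. The pipes of any full
sequence are feasible too (`feasible_pipes`), so `|B|` bounds their number.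

Switches are tied to pipes by two counts. If `T i ⊆ M i` for all `i`, every use of a tool is paid
for by the initial state, a switch or a pipe, so `∑ |T i| ≤ |pipes| + switches + |M 0|`
(`sum_card_le`). Conversely, `switches + |T 0| + |B| ≤ ∑ |T i|` for the states built from `B`
(`switches_build_add_le`).

ToFullMag never increases `switches + |M 0|` (`toFullMag_spec`) and ends with full magazines
(`card_toFullMag`). Its result therefore satisfies `switches + C + |B| ≤ ∑ |T i|`, which meets the
lower bound. It also contains the states built by GPCA and so keeps all their pipes. -/

namespace ToolLoading

/-! ### Greedy packing of intervals under capacities -/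

section Greedy

variable {n : ℕ} {α : Type*}

/-- The triples of `B` whose open interval contains the moment `i`. -/
def cover (B : Finset (Triple n α)) (i : Fin n) : Finset (Triple n α) :=
  B.filter fun p => i ∈ Finset.Ioo p.1 p.2.1

lemma mem_cover {B : Finset (Triple n α)} {i : Fin n} {p : Triple n α} :
    p ∈ cover B i ↔ p ∈ B ∧ p.1 < i ∧ i < p.2.1 := by
  simp [cover]

lemma cover_mono {B F : Finset (Triple n α)} (h : B ⊆ F) (i : Fin n) : cover B i ⊆ cover F i :=
  Finset.filter_subset_filter _ h

/-- Every moment `i` is covered by at most `c i` triples of `B`. -/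
def Feasible (c : Fin n → ℕ) (B : Finset (Triple n α)) : Prop :=
  ∀ i, (cover B i).card ≤ c i

variable [DecidableEq α]

/-- Add `p` to `B` if every moment covered by `p` has free capacity. -/
def accept (c : Fin n → ℕ) (B : Finset (Triple n α)) (p : Triple n α) : Finset (Triple n α) :=
  if ∀ i ∈ Finset.Ioo p.1 p.2.1, (cover B i).card < c i then insert p B else B

lemma cover_insert_of_mem {B : Finset (Triple n α)} {p : Triple n α} {i : Fin n}
    (h : i ∈ Finset.Ioo p.1 p.2.1) : cover (insert p B) i = insert p (cover B i) := by
  rw [cover, Finset.filter_insert, if_pos h, cover]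

lemma cover_insert_of_notMem {B : Finset (Triple n α)} {p : Triple n α} {i : Fin n}
    (h : i ∉ Finset.Ioo p.1 p.2.1) : cover (insert p B) i = cover B i := by
  rw [cover, Finset.filter_insert, if_neg h, cover]

lemma Feasible.accept {c : Fin n → ℕ} {B : Finset (Triple n α)} (hB : Feasible c B)
    (p : Triple n α) : Feasible c (accept c B p) := by
  unfold ToolLoading.accept
  split_ifs with h
  · intro i
    by_cases hi : i ∈ Finset.Ioo p.1 p.2.1
    · rw [cover_insert_of_mem hi]
      exact (Finset.card_insert_le _ _).trans (h i hi)
    · rw [cover_insert_of_notMem hi]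
      exact hB i
  · exact hB

lemma Feasible.foldl_accept {c : Fin n → ℕ} (l : List (Triple n α)) {B : Finset (Triple n α)}
    (hB : Feasible c B) : Feasible c (l.foldl (ToolLoading.accept c) B) := by
  induction l generalizing B with
  | nil => exact hB
  | cons p l ih => exact ih (hB.accept p)

/-- Feasibility of `F ⊇ insert p B` leaves a free slot in `B` wherever a new `p` passes. If `p` is
already in `B`, rejection changes nothing either. -/
lemma accept_of_mem_feasible {c : Fin n → ℕ} {B F : Finset (Triple n α)} {p : Triple n α}
    (hF : Feasible c F) (hBF : B ⊆ F) (hp : p ∈ F) : accept c B p = insert p B := by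
  unfold accept
  split_ifs with h
  · rfl
  · by_cases hpB : p ∈ B
    · exact (Finset.insert_eq_of_mem hpB).symm
    · refine absurd (fun i hi => ?_) h
      have h1 := (Finset.card_le_card
        (cover_mono (Finset.insert_subset hp hBF) i)).trans (hF i)
      rw [cover_insert_of_mem hi, Finset.card_insert_of_notMem fun h => hpB (mem_cover.1 h).1] at h1
      exact h1

/-- If a set `F` that extends `B` stays infeasible after adding the acceptable triple `p`, then
some element of `F` that is not in `B` can be exchanged for `p`, provided that the elements of `F`
outside `B` do not end before `p`. -/
lemma exists_exchange {c : Fin n → ℕ} {B F : Finset (Triple n α)} {p : Triple n α}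
    (hF : Feasible c F) (hp : ∀ i ∈ Finset.Ioo p.1 p.2.1, (cover B i).card < c i)
    (hend : ∀ q ∈ F, q ∉ B → p.2.1 ≤ q.2.1) (hinf : ¬ Feasible c (insert p F)) :
    ∃ q ∈ F, q ∉ B ∧ Feasible c (insert p (F.erase q)) := by
  have hne : (Finset.univ.filter fun i => c i < (cover (insert p F) i).card).Nonempty := by
    simp only [Feasible, not_forall, not_le] at hinf
    obtain ⟨i, hi⟩ := hinf
    exact ⟨i, by simpa using hi⟩
  -- Take the leftmost overloaded moment: before it `p` does no harm, and from it up to the end of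
  -- `p` the removal of `q` will free a slot.
  obtain ⟨i, hi, hmin⟩ := Finset.exists_min_image _ id hne
  simp only [Finset.mem_filter, Finset.mem_univ, true_and, id] at hi hmin
  have hip : i ∈ Finset.Ioo p.1 p.2.1 := by
    by_contra h
    rw [cover_insert_of_notMem h] at hi
    exact absurd (hF i) (not_le.2 hi)
  -- `F` is saturated at `i` while `B` still has room there, so some `q` in `F` but not in `B`
  -- covers `i`.
  have hcard : (cover B i).card < (cover F i).card := by
    rw [cover_insert_of_mem hip] at hi
    have := Finset.card_insert_le p (cover F i)
    have := hp i hip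
    omega
  obtain ⟨q, hq, hqB⟩ := Finset.exists_mem_notMem_of_card_lt_card hcard
  rw [mem_cover] at hq
  have hqB' : q ∉ B := fun h => hqB (mem_cover.2 ⟨h, hq.2⟩)
  refine ⟨q, hq.1, hqB', fun j => ?_⟩
  by_cases hj : j ∈ Finset.Ioo p.1 p.2.1
  · rcases lt_or_ge j i with hji | hij
    · have h1 : (cover (insert p F) j).card ≤ c j := by
        by_contra h
        exact absurd (hmin j (not_le.1 h)) (not_le.2 hji)
      exact (Finset.card_le_card (cover_mono
        (Finset.insert_subset_insert _ (Finset.erase_subset _ _)) j)).trans h1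
    -- Since `q` starts before `i ≤ j` and ends no earlier than `p`, it covers `j` as well.
    · have hqj : q ∈ cover F j := mem_cover.2 ⟨hq.1, hq.2.1.trans_le hij,
        (Finset.mem_Ioo.1 hj).2.trans_le (hend q hq.1 hqB')⟩
      have h1 : cover (F.erase q) j ⊆ (cover F j).erase q := by
        intro x hx
        rw [mem_cover, Finset.mem_erase] at hx
        exact Finset.mem_erase.2 ⟨hx.1.1, mem_cover.2 ⟨hx.1.2, hx.2⟩⟩
      have h2 := Finset.card_le_card h1
      rw [Finset.card_erase_of_mem hqj] at h2
      have h3 := Finset.card_pos.2 ⟨q, hqj⟩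
      have h4 := Finset.card_insert_le p (cover (F.erase q) j)
      have h5 := hF j
      rw [cover_insert_of_mem hj]
      omega
  · rw [cover_insert_of_notMem hj]
    exact (Finset.card_le_card (cover_mono (Finset.erase_subset _ _) j)).trans (hF j)

/-- Accepting intervals greedily in the order of their ends yields a largest feasible set. -/
theorem card_le_card_foldl_accept {c : Fin n → ℕ} (l : List (Triple n α))
    (hl : l.Pairwise fun p q => p.2.1 ≤ q.2.1) {B F : Finset (Triple n α)}
    (hF : Feasible c F) (hBF : B ⊆ F) (hFl : ∀ p ∈ F, p ∈ B ∨ p ∈ l) :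
    F.card ≤ (l.foldl (accept c) B).card := by
  induction l generalizing B F with
  | nil => exact Finset.card_le_card fun p hp => by simpa using hFl p hp
  | cons p l ih =>
    rw [List.pairwise_cons] at hl
    rw [List.foldl_cons]
    by_cases hpF : p ∈ F
    · rw [accept_of_mem_feasible hF hBF hpF]
      refine ih hl.2 hF (Finset.insert_subset hpF hBF) fun q hq => ?_
      have := hFl q hq
      simp only [List.mem_cons, Finset.mem_insert] at this ⊢
      tauto
    have hFl' : ∀ q ∈ F, q ∈ B ∨ q ∈ l := fun q hq => by
      rcases hFl q hq with h | h
      · exact Or.inl h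
      · rcases List.mem_cons.1 h with rfl | h
        · exact absurd hq hpF
        · exact Or.inr h
    by_cases hacc : ∀ i ∈ Finset.Ioo p.1 p.2.1, (cover B i).card < c i
    · rw [accept, if_pos hacc]
      by_cases hins : Feasible c (insert p F)
      · refine (Finset.card_le_card (Finset.subset_insert p F)).trans
          (ih hl.2 hins (Finset.insert_subset_insert _ hBF) fun q hq => ?_)
        rcases Finset.mem_insert.1 hq with rfl | hq
        · exact Or.inl (Finset.mem_insert_self _ _)
        · exact (hFl' q hq).imp_left (Finset.mem_insert_of_mem ·)
      -- Replace `q` by `p` in `F`: the size is kept, and the new set extends `insert p B`.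
      · obtain ⟨q, hqF, hqB, hfeas⟩ := exists_exchange hF hacc
          (fun q hq hqB => hl.1 q ((hFl' q hq).resolve_left hqB)) hins
        have hcard : (insert p (F.erase q)).card = F.card := by
          rw [Finset.card_insert_of_notMem fun h => hpF (Finset.mem_of_mem_erase h),
            Finset.card_erase_add_one hqF]
        rw [← hcard]
        refine ih hl.2 hfeas (Finset.insert_subset_insert _ fun x hx =>
          Finset.mem_erase.2 ⟨fun h => hqB (h ▸ hx), hBF hx⟩) fun x hx => ?_
        rcases Finset.mem_insert.1 hx with rfl | hx
        · exact Or.inl (Finset.mem_insert_self _ _)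
        · exact (hFl' x (Finset.mem_of_mem_erase hx)).imp_left (Finset.mem_insert_of_mem ·)
    · rw [accept, if_neg hacc]
      exact ih hl.2 hF hBF hFl'

end Greedy

/-! ### GPCA as interval packing -/

section Pipes

variable {n : ℕ} {α : Type*} [DecidableEq α] {T : Fin n → Finset α}

lemma mem_possiblePipes {p : Triple n α} : p ∈ possiblePipes T ↔
    p.1 < p.2.1 ∧ p.2.2 ∈ T p.1 ∧ p.2.2 ∈ T p.2.1 ∧ ∀ i, p.1 < i → i < p.2.1 → p.2.2 ∉ T i := by
  simp only [possiblePipes, Finset.mem_filter, Finset.mem_product, Finset.mem_univ, true_and,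
    Finset.mem_biUnion, Finset.mem_Ioo, and_imp, and_iff_right_iff_imp]
  exact fun _ h _ _ => ⟨_, h⟩

lemma mem_pipes {M : Fin n → Finset α} {p : Triple n α} :
    p ∈ pipes T M ↔ p ∈ possiblePipes T ∧ ∀ i, p.1 < i → i < p.2.1 → p.2.2 ∈ M i := by
  simp [pipes]

lemma mem_candidates {e : Fin n} {p : Triple n α} :
    p ∈ candidates T e ↔ p ∈ possiblePipes T ∧ p.2.1 = e := by
  simp [candidates]

/-- Two possible pipes for the same tool that end at the same moment start at the same moment. -/
lemma eq_of_mem_possiblePipes_of_end {p q : Triple n α} (hp : p ∈ possiblePipes T)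
    (hq : q ∈ possiblePipes T) (he : p.2.1 = q.2.1) (ht : p.2.2 = q.2.2) : p = q := by
  obtain ⟨s, e, t⟩ := p
  obtain ⟨s', e', t'⟩ := q
  simp only [mem_possiblePipes] at hp hq he ht
  subst he ht
  rcases lt_trichotomy s s' with h | rfl | h
  · exact absurd hq.2.1 (hp.2.2.2 _ h hq.1)
  · rfl
  · exact absurd hp.2.1 (hq.2.2.2 _ h hp.1)

/-- Two possible pipes for the same tool that cover the same moment are equal. -/
lemma eq_of_mem_possiblePipes_of_cover {p q : Triple n α} {i : Fin n} (hp : p ∈ possiblePipes T)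
    (hq : q ∈ possiblePipes T) (hpi : p.1 < i ∧ i < p.2.1) (hqi : q.1 < i ∧ i < q.2.1)
    (ht : p.2.2 = q.2.2) : p = q := by
  refine eq_of_mem_possiblePipes_of_end hp hq ?_ ht
  rw [mem_possiblePipes] at hp hq
  rcases lt_trichotomy p.2.1 q.2.1 with h | h | h
  · exact absurd (ht ▸ hp.2.2.1) (hq.2.2.2 _ (hqi.1.trans hpi.2) h)
  · exact h
  · exact absurd (ht ▸ hq.2.2.1) (hp.2.2.2 _ (hpi.1.trans hqi.2) h)

/-- The states obtained from `T` by building all pipes of `B`. -/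
def build (T : Fin n → Finset α) (B : Finset (Triple n α)) (i : Fin n) : Finset α :=
  T i ∪ (cover B i).image fun p => p.2.2

lemma mem_build {B : Finset (Triple n α)} {i : Fin n} {t : α} :
    t ∈ build T B i ↔ t ∈ T i ∨ ∃ p ∈ B, (p.1 < i ∧ i < p.2.1) ∧ p.2.2 = t := by
  simp only [build, Finset.mem_union, Finset.mem_image, mem_cover, and_assoc]

lemma injOn_tool_cover {B : Finset (Triple n α)} (hB : B ⊆ possiblePipes T) (i : Fin n) :
    Set.InjOn (fun p : Triple n α => p.2.2) (cover B i) := by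
  intro p hp q hq h
  rw [Finset.mem_coe, mem_cover] at hp hq
  exact eq_of_mem_possiblePipes_of_cover (hB hp.1) (hB hq.1) hp.2 hq.2 h

lemma disjoint_image_tool_cover {B : Finset (Triple n α)} (hB : B ⊆ possiblePipes T) (i : Fin n) :
    Disjoint (T i) ((cover B i).image fun p => p.2.2) := by
  rw [Finset.disjoint_right]
  intro t ht
  obtain ⟨p, hp, rfl⟩ := Finset.mem_image.1 ht
  rw [mem_cover] at hp
  exact (mem_possiblePipes.1 (hB hp.1)).2.2.2 i hp.2.1 hp.2.2

/-- Both unions are without overlap, because a possible pipe ends at the next use of its tool.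
Magazine capacity thus becomes a bound on the number of covering intervals. -/
lemma card_build {B : Finset (Triple n α)} (hB : B ⊆ possiblePipes T) (i : Fin n) :
    (build T B i).card = (T i).card + (cover B i).card := by
  rw [build, Finset.card_union_of_disjoint (disjoint_image_tool_cover hB i),
    Finset.card_image_of_injOn (injOn_tool_cover hB i)]

/-- GPCA and the abstract greedy run in lockstep. The pipe must be new, since otherwise the counter
could grow while `B` does not. -/
lemma tryBuild_build {C : ℕ} {B : Finset (Triple n α)} {p : Triple n α}
    (hB : B ⊆ possiblePipes T) (hpB : p ∉ B) :
    tryBuild C (build T B, B.card) p =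
      (build T (accept (fun i => C - (T i).card) B p),
        (accept (fun i => C - (T i).card) B p).card) := by
  -- Truncated subtraction is harmless here: if `C ≤ |T i|`, both inequalities fail.
  have hiff : (∀ i ∈ Finset.Ioo p.1 p.2.1, (build T B i).card < C) ↔
      ∀ i ∈ Finset.Ioo p.1 p.2.1, (cover B i).card < C - (T i).card := by
    refine forall₂_congr fun i _ => ?_
    rw [card_build hB]
    omega
  by_cases h : ∀ i ∈ Finset.Ioo p.1 p.2.1, (cover B i).card < C - (T i).card
  · rw [tryBuild, if_pos (hiff.2 h), accept, if_pos h, Finset.card_insert_of_notMem hpB]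
    congr 1
    funext i
    by_cases hi : i ∈ Finset.Ioo p.1 p.2.1
    · simp only [if_pos hi, build, cover_insert_of_mem hi, Finset.image_insert,
        Finset.union_insert]
    · simp only [if_neg hi, build, cover_insert_of_notMem hi]
  · rw [tryBuild, if_neg (mt hiff.1 h), accept, if_neg h]

lemma accept_subset_insert (c : Fin n → ℕ) (B : Finset (Triple n α)) (p : Triple n α) :
    accept c B p ⊆ insert p B := by
  unfold accept
  split_ifs
  · exact subset_rfl
  · exact Finset.subset_insert _ _

lemma foldl_accept_subset (c : Fin n → ℕ) {S : Finset (Triple n α)} (l : List (Triple n α))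
    {B : Finset (Triple n α)} (hB : B ⊆ S) (hl : ∀ p ∈ l, p ∈ S) :
    l.foldl (accept c) B ⊆ S := by
  induction l generalizing B with
  | nil => exact hB
  | cons p l ih =>
    rw [List.forall_mem_cons] at hl
    exact ih ((accept_subset_insert c B p).trans (Finset.insert_subset hl.1 hB)) hl.2

lemma foldl_tryBuild_build {C : ℕ} (l : List (Triple n α)) {B : Finset (Triple n α)}
    (hB : B ⊆ possiblePipes T) (hl : l.Nodup) (hlp : ∀ p ∈ l, p ∈ possiblePipes T)
    (hlB : ∀ p ∈ l, p ∉ B) :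
    l.foldl (tryBuild C) (build T B, B.card) =
      (build T (l.foldl (accept fun i => C - (T i).card) B),
        (l.foldl (accept fun i => C - (T i).card) B).card) := by
  induction l generalizing B with
  | nil => rfl
  | cons p l ih =>
    rw [List.forall_mem_cons] at hlp hlB
    rw [List.nodup_cons] at hl
    rw [List.foldl_cons, List.foldl_cons, tryBuild_build hB hlB.1]
    refine ih ((accept_subset_insert _ B p).trans (Finset.insert_subset hlp.1 hB)) hl.2 hlp.2
      fun q hq h => ?_
    rcases Finset.mem_insert.1 (accept_subset_insert _ B p h) with rfl | h
    · exact hl.1 hq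
    · exact hlB.2 q hq h

/-- The order in which `GPCA` tries the possible pipes. -/
def trialOrder (T : Fin n → Finset α)
    (σ : Fin n → Finset (Triple n α) → List (Triple n α)) : List (Triple n α) :=
  (List.finRange n).tail.flatMap fun e => σ e (candidates T e)

variable {σ : Fin n → Finset (Triple n α) → List (Triple n α)}

lemma mem_tail_finRange {s e : Fin n} (h : s < e) : e ∈ (List.finRange n).tail := by
  cases n with
  | zero => exact e.elim0
  | succ n =>
    rw [List.finRange_succ, List.tail_cons, List.mem_map]
    exact ⟨e.pred (Fin.ne_zero_of_lt h), List.mem_finRange _, Fin.succ_pred _ _⟩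

lemma pairwise_lt_tail_finRange (n : ℕ) : (List.finRange n).tail.Pairwise (· < ·) :=
  (List.pairwise_lt_finRange n).sublist (List.tail_sublist _)

lemma mem_trialOrder (hσ : IsEnumeration σ) {p : Triple n α} :
    p ∈ trialOrder T σ ↔ p ∈ possiblePipes T := by
  simp only [trialOrder, List.mem_flatMap, (hσ _ _).2, mem_candidates]
  exact ⟨fun ⟨_, _, h, _⟩ => h, fun h => ⟨_, mem_tail_finRange (mem_possiblePipes.1 h).1, h, rfl⟩⟩

lemma nodup_trialOrder (hσ : IsEnumeration σ) : (trialOrder T σ).Nodup := by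
  refine List.nodup_flatMap.2 ⟨fun e _ => (hσ _ _).1,
    (pairwise_lt_tail_finRange n).imp fun {a b} hab => ?_⟩
  intro p hp hq
  rw [(hσ _ _).2, mem_candidates] at hp hq
  exact hab.ne (hp.2.symm.trans hq.2)

lemma pairwise_end_trialOrder (hσ : IsEnumeration σ) :
    (trialOrder T σ).Pairwise fun p q => p.2.1 ≤ q.2.1 := by
  refine List.pairwise_flatMap.2 ⟨fun e _ => ?_,
    (pairwise_lt_tail_finRange n).imp fun {a b} hab p hp q hq => ?_⟩
  · refine List.pairwise_of_forall_mem_list fun p hp q hq => ?_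
    rw [(hσ _ _).2, mem_candidates] at hp hq
    exact (hp.2.trans hq.2.symm).le
  · rw [(hσ _ _).2, mem_candidates] at hp hq
    rw [hp.2, hq.2]
    exact hab.le

/-- `GPCA` builds the pipes of a largest feasible set of possible pipes. -/
theorem exists_GPCA_eq (T : Fin n → Finset α) (C : ℕ) (hσ : IsEnumeration σ) :
    ∃ B ⊆ possiblePipes T, GPCA T C σ = (build T B, B.card) ∧
      Feasible (fun i => C - (T i).card) B ∧
      ∀ F ⊆ possiblePipes T, Feasible (fun i => C - (T i).card) F → F.card ≤ B.card := by
  refine ⟨(trialOrder T σ).foldl (accept fun i => C - (T i).card) ∅,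
    foldl_accept_subset _ _ (Finset.empty_subset _) fun p hp => (mem_trialOrder hσ).1 hp, ?_,
    Feasible.foldl_accept _ fun i => by simp [cover], fun F hFp hF =>
    card_le_card_foldl_accept _ (pairwise_end_trialOrder hσ) hF (Finset.empty_subset _)
      fun p hp => Or.inr ((mem_trialOrder hσ).2 (hFp hp))⟩
  rw [← foldl_tryBuild_build _ (Finset.empty_subset _) (nodup_trialOrder hσ)
    (fun p hp => (mem_trialOrder hσ).1 hp) (by simp), GPCA, trialOrder, List.foldl_flatMap]
  congr 1
  simp only [Finset.card_empty, Prod.mk.injEq, and_true]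
  funext i
  simp [build, cover]

/-- A maximum set of possible pipes contains all those that cover no moment, and so the pipes of
the states obtained by building it are exactly its elements. -/
lemma pipes_build {c : Fin n → ℕ} {B : Finset (Triple n α)} (hB : B ⊆ possiblePipes T)
    (hfeas : Feasible c B)
    (hmax : ∀ F ⊆ possiblePipes T, Feasible c F → F.card ≤ B.card) :
    pipes T (build T B) = B := by
  ext p
  rw [mem_pipes]
  constructor
  · rintro ⟨hp, h⟩
    by_cases hi : ∃ i, p.1 < i ∧ i < p.2.1
    · obtain ⟨i, hi⟩ := hi
      rcases mem_build.1 (h i hi.1 hi.2) with h | ⟨q, hq, hqi, ht⟩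
      · exact absurd h ((mem_possiblePipes.1 hp).2.2.2 i hi.1 hi.2)
      · exact eq_of_mem_possiblePipes_of_cover (hB hq) hp hqi hi ht ▸ hq
    · by_contra hpB
      -- A pipe covering no moment uses no capacity, so adding it would contradict maximality.
      have h1 := hmax (insert p B) (Finset.insert_subset hp hB) fun i => by
        rw [cover_insert_of_notMem fun h => hi ⟨i, Finset.mem_Ioo.1 h⟩]
        exact hfeas i
      rw [Finset.card_insert_of_notMem hpB] at h1
      omega
  · exact fun hp => ⟨hB hp, fun i h1 h2 => mem_build.2 (Or.inr ⟨p, hp, ⟨h1, h2⟩, rfl⟩)⟩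

/-- The pipes of `M` over `i` have distinct tools in `M i \ T i`, which has `C - |T i|` elements. -/
lemma feasible_pipes {C : ℕ} {M : Fin n → Finset α} (hM : M ∈ magSeqs T C) :
    Feasible (fun i => C - (T i).card) (pipes T M) := by
  intro i
  beta_reduce
  have hsub : pipes T M ⊆ possiblePipes T := Finset.filter_subset _ _
  rw [← Finset.card_image_of_injOn (injOn_tool_cover hsub i), ← (hM i).2,
    ← Finset.card_sdiff_of_subset (hM i).1]
  refine Finset.card_le_card fun t ht => Finset.mem_sdiff.2
    ⟨?_, Finset.disjoint_right.1 (disjoint_image_tool_cover hsub i) ht⟩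
  obtain ⟨p, hp, rfl⟩ := Finset.mem_image.1 ht
  rw [mem_cover] at hp
  exact (mem_pipes.1 hp.1).2 i hp.2.1 hp.2.2

end Pipes

/-! ### Counting switches against pipes -/

section Switches

variable {k : ℕ} {α : Type*} [DecidableEq α] {T : Fin (k + 1) → Finset α}

lemma switches_succ (M : Fin (k + 1) → Finset α) :
    switches M = ∑ i : Fin k, (M i.succ \ M i.castSucc).card := rfl

/-- The possible pipes of `B` that end at the moment `e` are determined by their tools. -/
lemma injOn_tool_end {B : Finset (Triple (k + 1) α)} (hB : B ⊆ possiblePipes T)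
    (e : Fin (k + 1)) :
    Set.InjOn (fun p : Triple (k + 1) α => p.2.2) (B.filter fun p => p.2.1 = e) := by
  intro p hp q hq h
  rw [Finset.mem_coe, Finset.mem_filter] at hp hq
  exact eq_of_mem_possiblePipes_of_end (hB hp.1) (hB hq.1) (hp.2.trans hq.2.symm) h

lemma sum_card_end {B : Finset (Triple (k + 1) α)} (hB : B ⊆ possiblePipes T) :
    ∑ i : Fin k, (B.filter fun p => p.2.1 = i.succ).card = B.card := by
  -- No pipe ends at the first moment, so summing over successors misses none.
  have h0 : (B.filter fun p => p.2.1 = 0) = ∅ := by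
    refine Finset.filter_eq_empty_iff.2 fun p hp h => ?_
    exact absurd (h ▸ (mem_possiblePipes.1 (hB hp)).1) (Fin.not_lt_zero _)
  rw [Finset.card_eq_sum_card_fiberwise (f := fun p : Triple (k + 1) α => p.2.1)
    (t := Finset.univ) fun _ _ => Finset.mem_coe.2 (Finset.mem_univ _), Fin.sum_univ_succ, h0,
    Finset.card_empty, zero_add]

/-- Every pipe saves a switch. -/
lemma switches_build_add_le {B : Finset (Triple (k + 1) α)} (hB : B ⊆ possiblePipes T) :
    switches (build T B) + (build T B 0).card + B.card ≤ ∑ i, (T i).card := by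
  have h0 : build T B 0 = T 0 := by
    ext t
    simp [mem_build]
  have hstep : ∀ i : Fin k, (build T B i.succ \ build T B i.castSucc).card +
      (B.filter fun p => p.2.1 = i.succ).card ≤ (T i.succ).card := by
    intro i
    rw [← Finset.card_image_of_injOn (injOn_tool_end hB i.succ),
      ← Finset.card_union_of_disjoint]
    · refine Finset.card_le_card (Finset.union_subset (fun t ht => ?_) fun t ht => ?_)
      · rw [Finset.mem_sdiff] at ht
        rcases mem_build.1 ht.1 with h | ⟨p, hp, hpi, rfl⟩
        · exact h
        · refine absurd (mem_build.2 ?_) ht.2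
          rcases (Fin.le_castSucc_iff.2 hpi.1).lt_or_eq with h | h
          · exact Or.inr ⟨p, hp, ⟨h, Fin.castSucc_lt_succ.trans hpi.2⟩, rfl⟩
          · exact Or.inl (h ▸ (mem_possiblePipes.1 (hB hp)).2.1)
      · obtain ⟨p, hp, rfl⟩ := Finset.mem_image.1 ht
        rw [Finset.mem_filter] at hp
        exact hp.2 ▸ (mem_possiblePipes.1 (hB hp.1)).2.2.1
    · rw [Finset.disjoint_right]
      intro t ht hsd
      obtain ⟨p, hp, rfl⟩ := Finset.mem_image.1 ht
      rw [Finset.mem_filter] at hp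
      have hpp := mem_possiblePipes.1 (hB hp.1)
      refine (Finset.mem_sdiff.1 hsd).2 (mem_build.2 ?_)
      have hlt : p.1 < i.succ := hp.2 ▸ hpp.1
      rcases (Fin.le_castSucc_iff.2 hlt).lt_or_eq with h | h
      · exact Or.inr ⟨p, hp.1, ⟨h, hp.2 ▸ Fin.castSucc_lt_succ⟩, rfl⟩
      · exact Or.inl (h ▸ hpp.2.1)
  have hsum := Finset.sum_le_sum fun i (_ : i ∈ Finset.univ) => hstep i
  rw [Finset.sum_add_distrib, sum_card_end hB] at hsum
  rw [switches_succ, Fin.sum_univ_succ, h0]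
  omega

/-- The tools in the state `M i` that have not been needed since they were inserted. -/
def fresh (T M : Fin (k + 1) → Finset α) (i : Fin (k + 1)) : Finset α :=
  (M i).filter fun t => ∀ s ≤ i, t ∈ T s → ∃ j, s < j ∧ j ≤ i ∧ t ∉ M j

lemma mem_fresh {M : Fin (k + 1) → Finset α} {i : Fin (k + 1)} {t : α} :
    t ∈ fresh T M i ↔ t ∈ M i ∧ ∀ s ≤ i, t ∈ T s → ∃ j, s < j ∧ j ≤ i ∧ t ∉ M j := by
  simp [fresh]

lemma notMem_of_mem_fresh {M : Fin (k + 1) → Finset α} {i : Fin (k + 1)} {t : α}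
    (ht : t ∈ fresh T M i) : t ∉ T i := by
  intro h
  obtain ⟨j, h1, h2, -⟩ := (mem_fresh.1 ht).2 i le_rfl h
  exact absurd h2 (not_le.2 h1)

/-- A needed tool that was in the preceding state and not fresh there ends a pipe. -/
lemma exists_mem_pipes_of_notMem_fresh {M : Fin (k + 1) → Finset α} {i : Fin k} {t : α}
    (ht : t ∈ T i.succ) (htM : t ∈ M i.castSucc) (hfr : t ∉ fresh T M i.castSucc) :
    ∃ p ∈ pipes T M, p.2.1 = i.succ ∧ p.2.2 = t := by
  simp only [mem_fresh, not_and, not_forall, not_exists, not_not] at hfr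
  obtain ⟨s₀, hs₀, hts₀, hkeep⟩ := hfr htM
  -- The pipe starts at the last use of `t` before `i.succ`; this is no earlier than `s₀`, after
  -- which `t` was kept.
  obtain ⟨s, hs, hmax⟩ := Finset.exists_max_image
    (Finset.univ.filter fun s => s ≤ i.castSucc ∧ t ∈ T s) id ⟨s₀, by simp [hs₀, hts₀]⟩
  simp only [Finset.mem_filter, Finset.mem_univ, true_and, id, and_imp] at hs hmax
  refine ⟨(s, i.succ, t), mem_pipes.2 ⟨mem_possiblePipes.2 ⟨Fin.le_castSucc_iff.1 hs.1, hs.2, ht,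
    fun j hj hji h => absurd (hmax j (Fin.le_castSucc_iff.2 hji) h) (not_le.2 hj)⟩,
    fun j hj hji => ?_⟩, rfl, rfl⟩
  exact hkeep j ((hmax s₀ hs₀ hts₀).trans_lt hj) (Fin.le_castSucc_iff.2 hji)

/-- Every use of a tool is paid for by the initial state, by a switch, or by a pipe. -/
lemma sum_card_le {M : Fin (k + 1) → Finset α} (hM : ∀ i, T i ⊆ M i) :
    ∑ i, (T i).card ≤ (pipes T M).card + switches M + (M 0).card := by
  have hsub : pipes T M ⊆ possiblePipes T := Finset.filter_subset _ _
  have hdisj : ∀ i, Disjoint (T i) (fresh T M i) := fun i =>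
    Finset.disjoint_right.2 fun _ => notMem_of_mem_fresh
  -- Fresh tools are credit: their insertion or initial slot is counted, but no use has claimed it
  -- yet. The credit terms telescope in the sum.
  have hstep : ∀ i : Fin k, (T i.succ).card + (fresh T M i.succ).card ≤
      ((pipes T M).filter fun p => p.2.1 = i.succ).card + (fresh T M i.castSucc).card +
        (M i.succ \ M i.castSucc).card := by
    intro i
    rw [← Finset.card_union_of_disjoint (hdisj i.succ),
      ← Finset.card_image_of_injOn (injOn_tool_end hsub i.succ)]
    refine (Finset.card_le_card (t := ((Finset.image _ _) ∪ fresh T M i.castSucc) ∪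
      (M i.succ \ M i.castSucc)) fun t ht => ?_).trans ((Finset.card_union_le _ _).trans
        (Nat.add_le_add_right (Finset.card_union_le _ _) _))
    simp only [Finset.mem_union, Finset.mem_image, Finset.mem_filter, Finset.mem_sdiff]
    have htM : t ∈ M i.succ := by
      rcases Finset.mem_union.1 ht with h | h
      · exact hM _ h
      · exact (mem_fresh.1 h).1
    by_cases hprev : t ∈ M i.castSucc
    · by_cases hfr : t ∈ fresh T M i.castSucc
      · exact Or.inl (Or.inr hfr)
      · rcases Finset.mem_union.1 ht with h | h
        · obtain ⟨p, hp, h1, h2⟩ := exists_mem_pipes_of_notMem_fresh h hprev hfr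
          exact Or.inl (Or.inl ⟨p, ⟨hp, h1⟩, h2⟩)
        · refine absurd (mem_fresh.2 ⟨hprev, fun s hs hts => ?_⟩) hfr
          obtain ⟨j, h1, h2, h3⟩ :=
            (mem_fresh.1 h).2 s (hs.trans Fin.castSucc_lt_succ.le) hts
          refine ⟨j, h1, Fin.le_castSucc_iff.2 (h2.lt_of_ne ?_), h3⟩
          rintro rfl
          exact h3 htM
    · exact Or.inr ⟨htM, hprev⟩
  have hzero : (T 0).card + (fresh T M 0).card ≤ (M 0).card := by
    rw [← Finset.card_union_of_disjoint (hdisj 0)]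
    exact Finset.card_le_card (Finset.union_subset (hM 0) (Finset.filter_subset _ _))
  have hsum := Finset.sum_le_sum fun i (_ : i ∈ Finset.univ) => hstep i
  simp only [Finset.sum_add_distrib, sum_card_end hsub] at hsum
  have h1 := Fin.sum_univ_succ fun i => (fresh T M i).card
  have h2 := Fin.sum_univ_castSucc fun i => (fresh T M i).card
  rw [switches_succ, Fin.sum_univ_succ]
  omega

/-- The switches and the tools of the initial state count the same as the tools of the final
state and the removals. -/
lemma switches_add_card_zero (M : Fin (k + 1) → Finset α) :
    switches M + (M 0).card =
      ∑ i : Fin k, (M i.castSucc \ M i.succ).card + (M (Fin.last k)).card := by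
  have h : ∀ i : Fin k, (M i.succ \ M i.castSucc).card + (M i.castSucc).card =
      (M i.castSucc \ M i.succ).card + (M i.succ).card := fun i => by
    rw [Finset.card_sdiff_add_card, Finset.card_sdiff_add_card, Finset.union_comm]
  have hsum := Finset.sum_congr rfl fun i (_ : i ∈ Finset.univ) => h i
  rw [Finset.sum_add_distrib, Finset.sum_add_distrib] at hsum
  have h1 := Fin.sum_univ_succ fun i => (M i).card
  have h2 := Fin.sum_univ_castSucc fun i => (M i).card
  rw [switches_succ]
  omega

/-- Adding to a state tools of the preceding or of the following state does not increase the number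
of switches plus the number of tools in the initial state. -/
lemma switches_add_card_zero_le {M N : Fin (k + 1) → Finset α} {i : Fin k}
    {p : Fin (k + 1) × Fin (k + 1)}
    (hp : p = (i.castSucc, i.succ) ∨ p = (i.succ, i.castSucc)) (hMN : ∀ j, M j ⊆ N j)
    (hne : ∀ j ≠ p.2, N j = M j) (hN : N p.2 ⊆ M p.2 ∪ M p.1) :
    switches N + (N 0).card ≤ switches M + (M 0).card := by
  rcases hp with rfl | rfl
  -- A forward step leaves the first state alone, so insertions are compared term by term.
  · rw [switches_succ, switches_succ, hne 0 (Fin.succ_ne_zero i).symm]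
    refine Nat.add_le_add_right (Finset.sum_le_sum fun j _ => Finset.card_le_card ?_) _
    rcases eq_or_ne j i with rfl | hj
    · intro t ht
      rw [Finset.mem_sdiff] at ht ⊢
      have h1 := Finset.mem_union.1 (hN ht.1)
      have h2 : t ∉ M j.castSucc := fun h => ht.2 (hMN _ h)
      exact ⟨h1.resolve_right h2, h2⟩
    · rw [hne j.succ fun h => hj (Fin.succ_injective _ h)]
      exact Finset.sdiff_subset_sdiff subset_rfl (hMN _)
  -- A backward step leaves the last state alone, so removals are compared instead.
  · rw [switches_add_card_zero, switches_add_card_zero,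
      hne (Fin.last k) (Fin.castSucc_lt_last i).ne']
    refine Nat.add_le_add_right (Finset.sum_le_sum fun j _ => Finset.card_le_card ?_) _
    rcases eq_or_ne j i with rfl | hj
    · intro t ht
      rw [Finset.mem_sdiff] at ht ⊢
      have h1 := Finset.mem_union.1 (hN ht.1)
      have h2 : t ∉ M j.succ := fun h => ht.2 (hMN _ h)
      exact ⟨h1.resolve_right h2, h2⟩
    · rw [hne j.castSucc fun h => hj (Fin.castSucc_injective _ h)]
      exact Finset.sdiff_subset_sdiff subset_rfl (hMN _)

end Switches

/-! ### Single steps and sweeps of ToFullMag -/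

section Fill

variable {n : ℕ} {α : Type*} [DecidableEq α]

/-- Adding the tools of the list `l` that are not in `R`, as long as there is an empty slot. -/
lemma foldl_insert_spec {C : ℕ} {R : Finset α} (l : List α) (S : Finset α) (hRS : R ⊆ S)
    (hS : S.card ≤ C) :
    let S' := l.foldl (fun S t => if t ∉ R ∧ S.card < C then insert t S else S) S
    S ⊆ S' ∧ (∀ t ∈ S', t ∈ S ∨ t ∈ l) ∧ S'.card ≤ C ∧ (S'.card = C ∨ ∀ t ∈ l, t ∈ S') := by
  induction l generalizing S with
  | nil => simp [hS]
  | cons a l ih =>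
    simp only [List.foldl_cons]
    by_cases h : a ∉ R ∧ S.card < C
    · rw [if_pos h]
      obtain ⟨h1, h2, h3, h4⟩ := ih (insert a S) (hRS.trans (Finset.subset_insert _ _))
        ((Finset.card_insert_le _ _).trans h.2)
      refine ⟨(Finset.subset_insert _ _).trans h1, fun t ht => ?_, h3, h4.imp_right fun h4 => ?_⟩
      · have := h2 t ht
        simp only [Finset.mem_insert, List.mem_cons] at this ⊢
        tauto
      · exact List.forall_mem_cons.2 ⟨h1 (Finset.mem_insert_self _ _), h4⟩
    · rw [if_neg h]
      obtain ⟨h1, h2, h3, h4⟩ := ih S hRS hS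
      refine ⟨h1, fun t ht => (h2 t ht).imp_right (List.mem_cons_of_mem _), h3, ?_⟩
      by_cases ha : a ∈ R
      · exact h4.imp_right fun h4 => List.forall_mem_cons.2 ⟨h1 (hRS ha), h4⟩
      -- Here `a` was refused because `S` was full, and the fold only enlarges `S`.
      · have := Finset.card_le_card h1
        have : ¬ S.card < C := fun hlt => h ⟨ha, hlt⟩
        exact Or.inl (by omega)

variable {C : ℕ} {τ : Fin n × Fin n → Finset α → List α}

/-- One step of `toFullMag` for the pair `p`. -/
def fillPair (C : ℕ) (τ : Fin n × Fin n → Finset α → List α) (M : Fin n → Finset α)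
    (p : Fin n × Fin n) : Fin n → Finset α :=
  fillStep C M p.2 (τ p (M p.1))

lemma fillPair_of_ne (M : Fin n → Finset α) (p : Fin n × Fin n) {j : Fin n} (h : j ≠ p.2) :
    fillPair C τ M p j = M j :=
  Function.update_of_ne h _ _

lemma fillPair_spec (hτ : IsEnumeration τ) {M : Fin n → Finset α} (hM : ∀ i, (M i).card ≤ C)
    (p : Fin n × Fin n) :
    M p.2 ⊆ fillPair C τ M p p.2 ∧ fillPair C τ M p p.2 ⊆ M p.2 ∪ M p.1 ∧
      (fillPair C τ M p p.2).card ≤ C ∧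
      ((fillPair C τ M p p.2).card = C ∨ M p.1 ⊆ fillPair C τ M p p.2) := by
  have h := foldl_insert_spec (τ p (M p.1)) (M p.2) subset_rfl (hM p.2)
  simp only [(hτ _ _).2] at h
  rw [fillPair, fillStep, Function.update_self]
  exact ⟨h.1, fun t ht => Finset.mem_union.2 (h.2.1 t ht), h.2.2⟩

lemma subset_fillPair (hτ : IsEnumeration τ) {M : Fin n → Finset α} (hM : ∀ i, (M i).card ≤ C)
    (p : Fin n × Fin n) (i : Fin n) : M i ⊆ fillPair C τ M p i := by
  by_cases h : i = p.2
  · exact h ▸ (fillPair_spec hτ hM p).1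
  · rw [fillPair_of_ne M p h]

lemma card_fillPair_le (hτ : IsEnumeration τ) {M : Fin n → Finset α} (hM : ∀ i, (M i).card ≤ C)
    (p : Fin n × Fin n) (i : Fin n) : (fillPair C τ M p i).card ≤ C := by
  by_cases h : i = p.2
  · exact h ▸ (fillPair_spec hτ hM p).2.2.1
  · rw [fillPair_of_ne M p h]
    exact hM i

lemma foldl_fillPair (hτ : IsEnumeration τ) (l : List (Fin n × Fin n)) {M : Fin n → Finset α}
    (hM : ∀ i, (M i).card ≤ C) :
    ∀ i, M i ⊆ l.foldl (fillPair C τ) M i ∧ (l.foldl (fillPair C τ) M i).card ≤ C := by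
  induction l generalizing M with
  | nil => exact fun i => ⟨subset_rfl, hM i⟩
  | cons p l ih =>
    exact fun i => ⟨(subset_fillPair hτ hM p i).trans (ih (card_fillPair_le hτ hM p) i).1,
      (ih (card_fillPair_le hτ hM p) i).2⟩

lemma foldl_fillPair_of_ne (l : List (Fin n × Fin n)) (M : Fin n → Finset α) {i : Fin n}
    (h : ∀ p ∈ l, i ≠ p.2) : l.foldl (fillPair C τ) M i = M i := by
  induction l generalizing M with
  | nil => rfl
  | cons p l ih =>
    rw [List.forall_mem_cons] at h
    rw [List.foldl_cons, ih _ h.2, fillPair_of_ne M p h.1]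

/-- If no step changes a state that was involved in an earlier step, then at the end every step
`(i, j)` has filled the state `j` or put all tools of the state `i` into it. -/
lemma card_eq_or_subset_foldl_fillPair (hτ : IsEnumeration τ) (l : List (Fin n × Fin n))
    {M : Fin n → Finset α} (hM : ∀ i, (M i).card ≤ C) (hne : ∀ p ∈ l, p.1 ≠ p.2)
    (hl : l.Pairwise fun p q => p.1 ≠ q.2 ∧ p.2 ≠ q.2) :
    ∀ p ∈ l, (l.foldl (fillPair C τ) M p.2).card = C ∨
      l.foldl (fillPair C τ) M p.1 ⊆ l.foldl (fillPair C τ) M p.2 := by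
  induction l generalizing M with
  | nil => simp
  | cons p l ih =>
    rw [List.forall_mem_cons] at hne
    rw [List.pairwise_cons] at hl
    refine List.forall_mem_cons.2 ⟨?_, ih (card_fillPair_le hτ hM p) hne.2 hl.2⟩
    rw [List.foldl_cons, foldl_fillPair_of_ne l _ fun q hq => (hl.1 q hq).1,
      foldl_fillPair_of_ne l _ fun q hq => (hl.1 q hq).2, fillPair_of_ne M p hne.1]
    exact (fillPair_spec hτ hM p).2.2.2

end Fill

/-! ### Fullness and cost of the result of ToFullMag -/

section ToFullMag

variable {k C : ℕ} {α : Type*} [DecidableEq α]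
  {τ : Fin (k + 1) × Fin (k + 1) → Finset α → List α}

lemma consecutive_succ (k : ℕ) : consecutive (k + 1) =
    (List.finRange k).map fun i : Fin k => (i.castSucc, i.succ) := rfl

lemma reverse_map_swap_consecutive (k : ℕ) : ((consecutive (k + 1)).map Prod.swap).reverse =
    (List.finRange k).reverse.map fun i : Fin k => (i.succ, i.castSucc) := by
  rw [consecutive_succ, List.map_map, List.map_reverse]
  rfl

lemma toFullMag_eq (L : Fin (k + 1) → Finset α) : toFullMag C τ L =
    ((consecutive (k + 1)).map Prod.swap).reverse.foldl (fillPair C τ)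
      ((consecutive (k + 1)).foldl (fillPair C τ) L) := by
  rw [toFullMag, List.foldl_append]
  rfl

/-- If the tools of all states together suffice to fill a magazine, then after `toFullMag` all
magazines are full. -/
theorem card_toFullMag (hτ : IsEnumeration τ) {L : Fin (k + 1) → Finset α}
    (hL : ∀ i, (L i).card ≤ C) (hC : C ≤ (Finset.univ.biUnion L).card) (i : Fin (k + 1)) :
    (toFullMag C τ L i).card = C := by
  rw [toFullMag_eq]
  have hF := foldl_fillPair hτ (consecutive (k + 1)) hL
  have hforw := card_eq_or_subset_foldl_fillPair hτ (consecutive (k + 1)) hL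
    (by simp [consecutive_succ, Fin.castSucc_lt_succ.ne]) (by
      rw [consecutive_succ, List.pairwise_map]
      refine (List.pairwise_lt_finRange k).imp fun {a b} hab => ⟨?_, ?_⟩
      · exact (Fin.castSucc_lt_succ_iff.2 hab.le).ne
      · exact (Fin.succ_lt_succ_iff.2 hab).ne)
  set F := (consecutive (k + 1)).foldl (fillPair C τ) L
  simp only [consecutive_succ, List.forall_mem_map, List.mem_finRange, true_imp_iff] at hforw
  -- If the last state were not full after the forward sweep, no step could have stopped for lack of
  -- room, and the last state would contain all the tools, at least `C` of them.
  have hlast : (F (Fin.last k)).card = C := by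
    by_contra hne
    have hsub : ∀ i, F i ⊆ F (Fin.last k) := by
      intro i
      induction i using Fin.reverseInduction with
      | last => exact subset_rfl
      | cast i ih =>
        rcases hforw i with h | h
        · have := Finset.card_le_card ih
          have := (hF (Fin.last k)).2
          omega
        · exact h.trans ih
    have h1 := hC.trans (Finset.card_le_card
      (Finset.biUnion_subset.2 fun i _ => (hF i).1.trans (hsub i)))
    exact hne (le_antisymm (hF _).2 h1)
  have hG := foldl_fillPair hτ ((consecutive (k + 1)).map Prod.swap).reverse fun i => (hF i).2
  have hback := card_eq_or_subset_foldl_fillPair hτ ((consecutive (k + 1)).map Prod.swap).reverse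
    (fun i => (hF i).2)
    (by simp [consecutive_succ, Fin.castSucc_lt_succ.ne']) (by
      rw [reverse_map_swap_consecutive, List.pairwise_map, List.pairwise_reverse]
      refine (List.pairwise_lt_finRange k).imp fun {a b} hab => ⟨?_, ?_⟩
      · exact (Fin.castSucc_lt_succ_iff.2 hab.le).ne'
      · exact (Fin.castSucc_lt_castSucc_iff.2 hab).ne')
  set G := ((consecutive (k + 1)).map Prod.swap).reverse.foldl (fillPair C τ) F
  simp only [reverse_map_swap_consecutive, List.forall_mem_map, List.mem_reverse,
    List.mem_finRange, true_imp_iff] at hback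
  -- Fullness spreads backwards from the last state: each state is full or contains its full
  -- successor.
  induction i using Fin.reverseInduction with
  | last => exact le_antisymm (hG _).2 (hlast ▸ Finset.card_le_card (hG _).1)
  | cast i ih =>
    rcases hback i with h | h
    · exact h
    · exact le_antisymm (hG _).2 (ih ▸ Finset.card_le_card h)

/-- `toFullMag` adds tools, and it does not increase the number of switches plus the number of tools
in the initial state. -/
theorem toFullMag_spec (hτ : IsEnumeration τ) {L : Fin (k + 1) → Finset α}
    (hL : ∀ i, (L i).card ≤ C) :
    (∀ i, L i ⊆ toFullMag C τ L i) ∧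
      switches (toFullMag C τ L) + (toFullMag C τ L 0).card ≤ switches L + (L 0).card := by
  have key : ∀ l : List (Fin (k + 1) × Fin (k + 1)),
      (∀ p ∈ l, ∃ i : Fin k, p = (i.castSucc, i.succ) ∨ p = (i.succ, i.castSucc)) →
      ∀ M : Fin (k + 1) → Finset α, (∀ i, (M i).card ≤ C) →
        switches (l.foldl (fillPair C τ) M) + (l.foldl (fillPair C τ) M 0).card ≤
          switches M + (M 0).card := by
    intro l
    induction l with
    | nil => exact fun _ M _ => le_rfl
    | cons p l ih =>
      intro hl M hM
      rw [List.forall_mem_cons] at hl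
      obtain ⟨i, hi⟩ := hl.1
      exact (ih hl.2 _ (card_fillPair_le hτ hM p)).trans
        (switches_add_card_zero_le hi (subset_fillPair hτ hM p)
          (fun j hj => fillPair_of_ne M p hj) (fillPair_spec hτ hM p).2.1)
  rw [toFullMag_eq, ← List.foldl_append]
  refine ⟨fun i => (foldl_fillPair hτ _ hL i).1, key _ (fun p hp => ?_) L hL⟩
  rw [reverse_map_swap_consecutive, consecutive_succ, List.mem_append, List.mem_map,
    List.mem_map] at hp
  rcases hp with ⟨i, -, rfl⟩ | ⟨i, -, rfl⟩
  · exact ⟨i, Or.inl rfl⟩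
  · exact ⟨i, Or.inr rfl⟩

end ToFullMag

lemma exists_isEnumeration {κ β : Type*} : ∃ σ : κ → Finset β → List β, IsEnumeration σ :=
  ⟨fun _ S => S.toList, fun _ S => ⟨S.nodup_toList, fun _ => Finset.mem_toList⟩⟩

end ToolLoading

theorem theorem2 {α : Type*} [DecidableEq α] (n C : ℕ) (T : Fin n → Finset α)
    (hT : ∀ i, (T i).card ≤ C)
    (hC : C ≤ (Finset.univ.biUnion T).card)
    (σ : Fin n → Finset (Triple n α) → List (Triple n α)) (hσ : IsEnumeration σ) :
    (GPCA T C σ).2 = (pipes T (GPCA T C σ).1).card ∧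
    IsGreatest ((fun M => (pipes T M).card) '' magSeqs T C) (GPCA T C σ).2 ∧
    IsLeast ((fun M => (switches M : ℤ)) '' magSeqs T C)
      ((∑ i, ((T i).card : ℤ)) - (C : ℤ) - ((GPCA T C σ).2 : ℤ)) ∧
    ∀ τ : Fin n × Fin n → Finset α → List α, IsEnumeration τ →
      (∀ i, (GPCA T C σ).1 i ⊆ toFullMag C τ (GPCA T C σ).1 i) ∧
      switches (toFullMag C τ (GPCA T C σ).1) ≤ switches (GPCA T C σ).1 ∧
      toFullMag C τ (GPCA T C σ).1 ∈ magSeqs T C ∧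
      ∀ M ∈ magSeqs T C, switches (toFullMag C τ (GPCA T C σ).1) ≤ switches M := by
  obtain ⟨B, hB, hGPCA, hfeas, hmax⟩ := exists_GPCA_eq T C hσ
  have hpipes := pipes_build hB hfeas hmax
  rw [hGPCA]
  dsimp only
  have hle : ∀ M ∈ magSeqs T C, (pipes T M).card ≤ B.card := fun M hM =>
    hmax _ (Finset.filter_subset _ _) (feasible_pipes hM)
  have hTB : ∀ i, T i ⊆ build T B i := fun i => Finset.subset_union_left
  have hcard : ∀ i, (build T B i).card ≤ C := fun i => by
    have h : (cover B i).card ≤ C - (T i).card := hfeas i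
    have := hT i
    rw [card_build hB]
    omega
  have hCB : C ≤ (Finset.univ.biUnion (build T B)).card :=
    hC.trans (Finset.card_le_card (Finset.biUnion_mono fun i _ => hTB i))
  -- Lower bound on switches: `M 0` has exactly `C` tools and `M` has at most `|B|` pipes.
  have hlower : ∀ M ∈ magSeqs T C, ∑ i, (T i).card ≤ B.card + switches M + C := by
    intro M hM
    cases n with
    | zero => simp
    | succ k =>
      have := sum_card_le fun i => (hM i).1
      have := hle M hM
      have := (hM 0).2
      omega
  have hfull : ∀ τ : Fin n × Fin n → Finset α → List α, IsEnumeration τ →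
      (∀ i, build T B i ⊆ toFullMag C τ (build T B) i) ∧
      switches (toFullMag C τ (build T B)) ≤ switches (build T B) ∧
      toFullMag C τ (build T B) ∈ magSeqs T C ∧
      switches (toFullMag C τ (build T B)) + C + B.card ≤ ∑ i, (T i).card := by
    intro τ hτ
    cases n with
    | zero =>
      -- Without jobs there are no tools, so the capacity must vanish for the formula to hold.
      have hC0 : C = 0 := by simpa using hC
      have hB0 : B = ∅ := Finset.eq_empty_of_forall_notMem fun p => p.1.elim0
      exact ⟨fun i => i.elim0, by simp [switches], fun i => i.elim0,
        by simp [switches, hC0, hB0]⟩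
    | succ k =>
      obtain ⟨h1, h2⟩ := toFullMag_spec hτ hcard
      have h3 := card_toFullMag hτ hcard hCB
      have h4 := switches_build_add_le hB
      have h5 := Finset.card_le_card (h1 0)
      have h6 := h3 0
      -- The first state only grows, so the bound on `switches + |M 0|` gives one on `switches`
      -- alone; its final size `C` supplies the term `C`.
      exact ⟨h1, by omega, fun i => ⟨(hTB i).trans (h1 i), h3 i⟩, by omega⟩
  refine ⟨by rw [hpipes], ?_, ?_, fun τ hτ => ?_⟩
  · obtain ⟨τ, hτ⟩ := exists_isEnumeration (κ := Fin n × Fin n) (β := α)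
    obtain ⟨h1, -, h2, -⟩ := hfull τ hτ
    refine ⟨⟨_, h2, le_antisymm (hle _ h2) (Finset.card_le_card fun p hp => ?_)⟩, ?_⟩
    · rw [← hpipes, mem_pipes] at hp
      exact mem_pipes.2 ⟨hp.1, fun i hi hi' => h1 i (hp.2 i hi hi')⟩
    · rintro _ ⟨M, hM, rfl⟩
      exact hle M hM
  · obtain ⟨τ, hτ⟩ := exists_isEnumeration (κ := Fin n × Fin n) (β := α)
    obtain ⟨-, -, h2, h3⟩ := hfull τ hτ
    refine ⟨⟨_, h2, ?_⟩, ?_⟩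
    · have := hlower _ h2
      push_cast [← Nat.cast_sum]
      omega
    · rintro _ ⟨M, hM, rfl⟩
      have := hlower M hM
      push_cast [← Nat.cast_sum]
      omega
  · obtain ⟨h1, h2, h3, h4⟩ := hfull τ hτ
    exact ⟨h1, h2, h3, fun M hM => by have := hlower M hM; omega⟩
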